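/- Let $X_1,X_2,\dots$ be iid real random variables with distribution function $F$, whose right endpoint $x_F=\sup\{x:F(x)<1\}$ is finite, and suppose that for some $\xi<0$ the function $U(x)=1-F(x_F-x^{-1})$ is regularly varying at infinity with index $1/\xi$, i.e. $\lim_{t\to\infty}U(tx)/U(t)=x^{1/\xi}$ for every $x>0$. Let $k=k_n$ be a sequence of positive integers with $k_n\to\infty$ and $k_n/n\to0$. For each $n$ let $X_{(1)}\ge X_{(2)}\ge\cdots\ge X_{(n)}$ be the order statistics of $X_1,\dots,X_n$, and let $$\hat M(u)=\frac{\sum_{j=1}^n (X_j-u)\,I_{[X_j>u]}}{\sum_{j=1}^n I_{[X_j>u]}}$$ be the empirical mean excess function. (The events on which one of the denominators occurring below vanishes because of ties have probability tending to $0$ as $n\to\infty$; the values assigned there are immaterial.) Then, as $n\to\infty$, $$\mathcal S_n:=\frac{1}{X_{(1)}-X_{(k)}}\Big\{\big(X_{(i)}-X_{(k)},\,\hat M(X_{(i)})\big):1<i\le k\Big\}\ \longrightarrow\ \mathcal S:=\Big\{\Big(t,\frac{\xi}{1-\xi}(t-1)\Big):0\le t\le1\Big\}$$ in probability, in the space of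 closed subsets of $\mathbb R^2$ with the Fell topology, i.e. the topology generated by the families $\{A \text{ closed}: A\cap K=\emptyset\}$, $K$ compact, and $\{A\text{ closed}: A\cap G\ne\emptyset\}$, $G$ open. In other words, for every Fell-open family $\mathcal U$ containing $\mathcal S$, $P[\mathcal S_n\notin\mathcal U]\to0$. -/

import Mathlib

open MeasureTheory ProbabilityTheory Filter Topology TopologicalSpace

noncomputable section

/-- Regular variation at infinity with index `ρ`: `U (t x) / U t → x ^ ρ` as `t → ∞`, for every
`x > 0`. -/
def RegularlyVarying (U : ℝ → ℝ) (ρ : ℝ) : Prop :=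
  ∀ x : ℝ, 0 < x → Tendsto (fun t : ℝ => U (t * x) / U t) atTop (𝓝 (x ^ ρ))

/-- The Fell topology on the closed subsets of `E`, generated by the families of closed sets that
miss a given compact set and the families of closed sets that hit a given open set. -/
@[reducible] def fellTopology (E : Type*) [TopologicalSpace E] : TopologicalSpace (Closeds E) :=
  TopologicalSpace.generateFrom
    ({𝒰 | ∃ K : Set E, IsCompact K ∧ 𝒰 = {F : Closeds E | (F : Set E) ∩ K = ∅}} ∪
     {𝒰 | ∃ G : Set E, IsOpen G ∧ 𝒰 = {F : Closeds E | ((F : Set E) ∩ G).Nonempty}})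

/-- Convergence in probability, with respect to the topology `τ`, of a sequence `Z` of random
elements of `E` to the non-random element `z`: the probability that `Z n` is outside a given open
neighbourhood of `z` tends to `0`. For a metric inducing `τ` this is the usual definition, see
`tendstoInProbability_iff_tendstoInMeasure`. -/
def TendstoInProbability {Ω E : Type*} [MeasurableSpace Ω] (P : Measure Ω)
    (τ : TopologicalSpace E) (Z : ℕ → Ω → E) (z : E) : Prop :=
  ∀ U : Set E, IsOpen[τ] U → z ∈ U → Tendsto (fun n => P {ω | Z n ω ∉ U}) atTop (𝓝 0)

theorem tendstoInProbability_iff_tendstoInMeasure {Ω E : Type*} [MeasurableSpace Ω]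
    (P : Measure Ω) [d : MetricSpace E] (Z : ℕ → Ω → E) (z : E) :
    TendstoInProbability P d.toUniformSpace.toTopologicalSpace Z z ↔
      TendstoInMeasure P Z atTop (fun _ => z) := by
  rw [tendstoInMeasure_iff_dist]
  constructor
  · intro h ε hε
    have h1 := h (Metric.ball z ε) Metric.isOpen_ball (Metric.mem_ball_self hε)
    simpa [Metric.mem_ball] using h1
  · intro h U hU hz
    obtain ⟨ε, hε, hb⟩ := Metric.isOpen_iff.1 hU z hz
    refine tendsto_of_tendsto_of_tendsto_of_le_of_le tendsto_const_nhds (h ε hε)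
      (fun _ => zero_le) (fun n => measure_mono ?_)
    intro ω hω
    by_contra hlt
    exact hω (hb (Metric.mem_ball.2 (not_le.1 hlt)))

/-- `orderStat x i` is the `i`-th largest entry of the sample `x`, for `1 ≤ i ≤ n`
(`Tuple.sort (-x)` is a permutation that puts the sample in decreasing order);
the value is `0` for all other `i`. -/
def orderStat {n : ℕ} (x : Fin n → ℝ) (i : ℕ) : ℝ :=
  if h : 1 ≤ i ∧ i ≤ n then x (Tuple.sort (-x) ⟨i - 1, by omega⟩) else 0

/-- The empirical mean excess function of the sample `x` at the level `u`. -/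
def empiricalMeanExcess {n : ℕ} (x : Fin n → ℝ) (u : ℝ) : ℝ :=
  (∑ j, if u < x j then x j - u else (0 : ℝ)) / (∑ j, if u < x j then (1 : ℝ) else 0)

/-- The mean excess plot over the `k` largest entries of the sample `x`, relocated by the `k`-th
largest entry and scaled by the distance between the largest and the `k`-th largest entry. -/
def normalizedMEPlot {n : ℕ} (x : Fin n → ℝ) (k : ℕ) : Closeds (ℝ × ℝ) where
  carrier :=
    (fun i : ℕ => (1 / (orderStat x 1 - orderStat x k)) •
      (orderStat x i - orderStat x k, empiricalMeanExcess x (orderStat x i))) '' Set.Ioc 1 k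
  isClosed' := ((Set.finite_Ioc 1 k).image _).isClosed

/-- The segment of all points `(t, ξ / (1 - ξ) * (t - 1))` with `0 ≤ t ≤ 1`. -/
def limitSegment (ξ : ℝ) : Closeds (ℝ × ℝ) where
  carrier := (fun t : ℝ => (t, ξ / (1 - ξ) * (t - 1))) '' Set.Icc 0 1
  isClosed' := (isCompact_Icc.image (by fun_prop)).isClosed

end

/-! Put `α = -1/ξ > 0` and measure distances below `xF` in units of `d n`, roughly the `k n / n`
quantile of `xF - X`. The number of sample points within `u * d n` of `xF`, divided by `k n`, has
mean tending to `u ^ α` by regular variation (`exists_scale`) and vanishing variance, so it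
converges in probability (`tendsto_exceedanceCount_div`).

The rest is deterministic. Inverting these counts locates the order statistics: index `i` with `i /
k → s ^ α` lies at scaled distance `s`. Integrating them gives the numerator of the mean excess, so
the scaled mean excess at distance `s` tends to `s ^ (α + 1) / (α + 1) / s ^ α = s / (α + 1)`. The
plot thus accumulates on the points `(1 - s, s / (α + 1))`, `0 ≤ s ≤ 1`, which form the limit
segment.

Convergence in probability is encoded as the filter `inProbability P`, so the deterministic limits,
proved along arbitrary filters, apply to it directly, without almost surely convergent subsequences.
-/

noncomputable section

/-! ### Order statistics and exceedance counts. -/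

/-- The number of entries of the sample `x` that exceed the level `u`. -/
def exceedanceCount {n : ℕ} (x : Fin n → ℝ) (u : ℝ) : ℕ :=
  (Finset.univ.filter fun j => u < x j).card

theorem exceedanceCount_antitone {n : ℕ} (x : Fin n → ℝ) : Antitone (exceedanceCount x) := by
  intro u v huv
  refine Finset.card_le_card fun j hj => ?_
  simp only [Finset.mem_filter, Finset.mem_univ, true_and] at hj ⊢
  exact huv.trans_lt hj

theorem cast_exceedanceCount {n : ℕ} (x : Fin n → ℝ) (u : ℝ) :
    (exceedanceCount x u : ℝ) = ∑ j, if u < x j then (1 : ℝ) else 0 := by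
  simp [exceedanceCount]

/-- In decreasing order the entries above `u` form an initial block. This duality carries limits of
counts over to order statistics. -/
theorem lt_orderStat_iff {n : ℕ} (x : Fin n → ℝ) {i : ℕ} (hi : 1 ≤ i) (hin : i ≤ n) (u : ℝ) :
    u < orderStat x i ↔ i ≤ exceedanceCount x u := by
  have hanti : Antitone (x ∘ Tuple.sort (-x)) := by
    intro a b hab
    simpa using Tuple.monotone_sort (-x) hab
  have hcard : exceedanceCount x u =
      (Finset.univ.filter fun j => u < (x ∘ Tuple.sort (-x)) j).card :=
    (Finset.card_equiv (Tuple.sort (-x)) (by simp)).symm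
  have := Tuple.lt_card_gt_iff_apply_gt_of_antitone (j := ⟨i - 1, by omega⟩) (a := u) hanti
  rw [orderStat, dif_pos ⟨hi, hin⟩, hcard]
  rw [← Function.comp_apply (f := x), ← this]
  simp only
  omega

theorem orderStat_antitone {n : ℕ} (x : Fin n → ℝ) {i j : ℕ} (hi : 1 ≤ i) (hij : i ≤ j)
    (hj : j ≤ n) : orderStat x j ≤ orderStat x i := by
  refine le_of_forall_lt fun u hu => ?_
  rw [lt_orderStat_iff x (hi.trans hij) hj] at hu
  exact (lt_orderStat_iff x hi (hij.trans hj) u).2 (hij.trans hu)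

theorem orderStat_le {n : ℕ} {x : Fin n → ℝ} {b : ℝ} (hx : ∀ j, x j ≤ b) {i : ℕ} (hi : 1 ≤ i)
    (hin : i ≤ n) : orderStat x i ≤ b := by
  rw [orderStat, dif_pos ⟨hi, hin⟩]
  exact hx _

/-! ### Pointwise limits of monotone functions. -/

/-- If monotone functions converge pointwise on a dense set of positive numbers, then they converge
along converging arguments at every positive continuity point of the limit. -/
theorem tendsto_apply_of_monotone {ι : Type*} {L : Filter ι} {f : ι → ℝ → ℝ}
    (hf : ∀ p, Monotone (f p)) {g : ℝ → ℝ} {s : ℝ} (hs : 0 < s) (hg : ContinuousAt g s)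
    {D : Set ℝ} (hD : Dense D) (hfg : ∀ u ∈ D, 0 < u → Tendsto (fun p => f p u) L (𝓝 (g u)))
    {σ : ι → ℝ} (hσ : Tendsto σ L (𝓝 s)) :
    Tendsto (fun p => f p (σ p)) L (𝓝 (g s)) := by
  refine tendsto_order.2 ⟨fun a ha => ?_, fun a ha => ?_⟩
  · obtain ⟨l, hl, hlt⟩ := exists_Ioc_subset_of_mem_nhds (hg.eventually (lt_mem_nhds ha)) ⟨0, hs⟩
    obtain ⟨u, hu, hu1, hu2⟩ := hD.exists_between (max_lt hl hs)
    have h1 : a < g u := hlt ⟨(le_max_left _ _).trans_lt hu1, hu2.le⟩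
    filter_upwards [(hfg u hu ((le_max_right _ _).trans_lt hu1)).eventually (lt_mem_nhds h1),
      hσ.eventually (lt_mem_nhds hu2)] with p hp1 hp2
    exact hp1.trans_le (hf p hp2.le)
  · obtain ⟨l, hl, hlt⟩ := exists_Ico_subset_of_mem_nhds (hg.eventually (gt_mem_nhds ha))
      ⟨s + 1, by linarith⟩
    obtain ⟨u, hu, hu1, hu2⟩ := hD.exists_between hl
    have h1 : g u < a := hlt ⟨hu1.le, hu2⟩
    filter_upwards [(hfg u hu (hs.trans hu1)).eventually (gt_mem_nhds h1),
      hσ.eventually (gt_mem_nhds hu1)] with p hp1 hp2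
    exact (hf p hp2.le).trans_lt hp1

/-- Dominated convergence for monotone functions, along an arbitrary filter. -/
theorem tendsto_integral_of_monotone {ι : Type*} {L : Filter ι} {f : ι → ℝ → ℝ}
    (hf : ∀ p, Monotone (f p)) (hf0 : ∀ p u, 0 ≤ f p u) {g : ℝ → ℝ} (hg : Continuous g)
    (hfg : ∀ u, 0 < u → Tendsto (fun p => f p u) L (𝓝 (g u))) {b : ℝ} (hb : 0 < b) :
    Tendsto (fun p => ∫ u in (0)..b, f p u) L (𝓝 (∫ u in (0)..b, g u)) := by
  -- Dominated convergence needs a countably generated filter, which `L` need not be. Convergence at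
  -- the positive rationals defines such a filter `M` on the space of monotone nonnegative
  -- functions, and `L` maps into it.
  let T := {φ : ℝ → ℝ // Monotone φ ∧ ∀ u, 0 ≤ φ u}
  let M : Filter T := ⨅ q : {q : ℚ // 0 < q}, comap (fun φ : T => φ.1 (q : ℚ)) (𝓝 (g (q : ℚ)))
  have hM : ∀ q : ℚ, 0 < q → Tendsto (fun φ : T => φ.1 q) M (𝓝 (g q)) := fun q hq =>
    tendsto_comap.mono_left (iInf_le _ (⟨q, hq⟩ : {q : ℚ // 0 < q}))
  have hpt : ∀ u, 0 < u → Tendsto (fun φ : T => φ.1 u) M (𝓝 (g u)) := by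
    intro u hu
    refine tendsto_apply_of_monotone (fun φ : T => φ.2.1) hu hg.continuousAt
      Rat.denseRange_cast ?_ tendsto_const_nhds
    rintro _ ⟨q, rfl⟩ hq
    exact hM q (by exact_mod_cast hq)
  have hint : Tendsto (fun φ : T => ∫ u in (0)..b, φ.1 u) M (𝓝 (∫ u in (0)..b, g u)) := by
    have : M.IsCountablyGenerated := iInf.isCountablyGenerated _
    refine intervalIntegral.tendsto_integral_filter_of_dominated_convergence
      (fun _ => g b + 1) ?_ ?_ intervalIntegrable_const ?_
    · exact Eventually.of_forall fun φ => φ.2.1.measurable.aestronglyMeasurable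
    · filter_upwards [(hpt b hb).eventually (gt_mem_nhds (lt_add_one (g b)))] with φ hφ
      refine Eventually.of_forall fun u hu => ?_
      rw [Set.uIoc_of_le hb.le] at hu
      rw [Real.norm_of_nonneg (φ.2.2 u)]
      exact (φ.2.1 hu.2).trans hφ.le
    · refine Eventually.of_forall fun u hu => ?_
      rw [Set.uIoc_of_le hb.le] at hu
      exact hpt u hu.1
  have hL : Tendsto (fun p => (⟨f p, hf p, hf0 p⟩ : T)) L M :=
    tendsto_iInf.2 fun q => tendsto_comap_iff.2 (hfg _ (by exact_mod_cast q.2))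
  exact hint.comp hL

theorem integral_ite_lt {b c : ℝ} (hb : 0 ≤ b) (hc : 0 ≤ c) :
    ∫ u in (0)..b, (if c < u then (1 : ℝ) else 0) = max (b - c) 0 := by
  have : (fun u : ℝ => if c < u then (1 : ℝ) else 0) = (Set.Ioi c).indicator 1 := by
    ext u; simp [Set.indicator_apply]
  rw [intervalIntegral.integral_of_le hb, this, integral_indicator_one measurableSet_Ioi,
    measureReal_restrict_apply measurableSet_Ioi, Set.inter_comm, Set.Ioc_inter_Ioi,
    max_eq_right hc, Real.volume_real_Ioc]

/-! ### The mean excess as a ratio of tail functions. -/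

/-- The tail empirical distribution function of the distances `(b - x j) / d`, with mass `1 / k` at
each of them. -/
def tailEmpirical {n : ℕ} (x : Fin n → ℝ) (k : ℕ) (b d : ℝ) (u : ℝ) : ℝ :=
  exceedanceCount x (b - u * d) / k

/-- The integrated tail empirical distribution function. -/
def integratedTail {n : ℕ} (x : Fin n → ℝ) (k : ℕ) (b d : ℝ) (u : ℝ) : ℝ :=
  (∑ j, max (u - (b - x j) / d) 0) / k

section

variable {n : ℕ} {x : Fin n → ℝ} {k : ℕ} {b d : ℝ}

theorem tailEmpirical_monotone (hd : 0 < d) : Monotone (tailEmpirical x k b d) := by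
  intro u v huv
  have : exceedanceCount x (b - u * d) ≤ exceedanceCount x (b - v * d) :=
    exceedanceCount_antitone x (by nlinarith)
  unfold tailEmpirical
  gcongr

theorem tailEmpirical_nonneg (u : ℝ) : 0 ≤ tailEmpirical x k b d u := by
  unfold tailEmpirical; positivity

theorem integratedTail_monotone : Monotone (integratedTail x k b d) := by
  intro u v huv
  unfold integratedTail
  gcongr

theorem integratedTail_nonneg (u : ℝ) : 0 ≤ integratedTail x k b d u :=
  div_nonneg (Finset.sum_nonneg fun _ _ => le_max_right _ _) k.cast_nonneg

theorem sub_mul_lt_iff (hd : 0 < d) (u y : ℝ) : b - u * d < y ↔ (b - y) / d < u := by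
  rw [div_lt_iff₀ hd]; constructor <;> intro h <;> linarith

theorem tailEmpirical_eq_sum (hd : 0 < d) (u : ℝ) :
    tailEmpirical x k b d u = (∑ j, if (b - x j) / d < u then (1 : ℝ) else 0) / k := by
  simp only [tailEmpirical, cast_exceedanceCount, sub_mul_lt_iff hd]

/-- Each sample point contributes a unit step, whose integral is a positive part. Hence a limit of
the counts determines the limit of the mean excess. -/
theorem integral_tailEmpirical (hd : 0 < d) (hx : ∀ j, x j ≤ b) {u : ℝ} (hu : 0 ≤ u) :
    ∫ v in (0)..u, tailEmpirical x k b d v = integratedTail x k b d u := by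
  simp only [tailEmpirical_eq_sum hd]
  rw [intervalIntegral.integral_div, intervalIntegral.integral_finsetSum]
  · simp only [integratedTail]
    congr 1
    refine Finset.sum_congr rfl fun j _ => ?_
    exact integral_ite_lt hu (div_nonneg (sub_nonneg.2 (hx j)) hd.le)
  · intro j _
    refine Monotone.intervalIntegrable fun v w hvw => ?_
    split_ifs with h1 h2 <;> first | exact le_rfl | exact zero_le_one | skip
    exact absurd (h1.trans_le hvw) h2

/-- Each point counted contributes at most `u`. This controls the ratio near `u = 0`, where both
limits vanish. -/
theorem integratedTail_le (hd : 0 < d) (hx : ∀ j, x j ≤ b) (u : ℝ) :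
    integratedTail x k b d u ≤ u * tailEmpirical x k b d u := by
  rw [tailEmpirical_eq_sum hd, integratedTail, mul_div_assoc', Finset.mul_sum]
  refine div_le_div_of_nonneg_right (Finset.sum_le_sum fun j _ => ?_) k.cast_nonneg
  have := div_nonneg (sub_nonneg.2 (hx j)) hd.le
  split_ifs with h
  · rw [max_eq_left (by linarith)]; linarith
  · rw [max_eq_right (by linarith)]; simp

theorem empiricalMeanExcess_div (hd : 0 < d) (hk : 0 < k) (u : ℝ) :
    empiricalMeanExcess x (b - u * d) / d =
      integratedTail x k b d u / tailEmpirical x k b d u := by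
  have h1 : (∑ j, if b - u * d < x j then x j - (b - u * d) else (0 : ℝ)) =
      d * ∑ j, max (u - (b - x j) / d) 0 := by
    rw [Finset.mul_sum]
    refine Finset.sum_congr rfl fun j _ => ?_
    have := sub_mul_lt_iff (b := b) hd u (x j)
    split_ifs with h
    · rw [max_eq_left (by linarith [this.1 h])]
      field_simp
      ring
    · rw [max_eq_right (by linarith [not_lt.1 (mt this.2 h)])]; simp
  have hk' : (k : ℝ) ≠ 0 := by positivity
  rw [empiricalMeanExcess, ← cast_exceedanceCount, h1, integratedTail, tailEmpirical,
    div_div_div_cancel_right₀ hk', mul_div_assoc, mul_div_cancel_left₀ _ hd.ne']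

end

end

/-! ### Deterministic limits along an arbitrary filter. -/

noncomputable section

/-- A family of samples, bounded above by `b`, whose tail empirical distribution functions, at
scale `d`, converge to `u ↦ u ^ α` along the filter `L`. -/
structure IsTailRegular {ι : Type*} (L : Filter ι) (n k : ι → ℕ) (x : ∀ p, Fin (n p) → ℝ)
    (b : ℝ) (d : ι → ℝ) (α : ℝ) : Prop where
  tendsto_k : Tendsto k L atTop
  k_le : ∀ᶠ p in L, k p ≤ n p
  d_pos : ∀ p, 0 < d p
  le_b : ∀ᶠ p in L, ∀ j, x p j ≤ b
  tendsto_tail : ∀ u, 0 < u →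
    Tendsto (fun p => tailEmpirical (x p) (k p) b (d p) u) L (𝓝 (u ^ α))

namespace IsTailRegular

variable {ι : Type*} {L : Filter ι} {n k : ι → ℕ} {x : ∀ p, Fin (n p) → ℝ} {b : ℝ} {d : ι → ℝ}
  {α : ℝ}

theorem comp (h : IsTailRegular L n k x b d α) {κ : Type*} {W : Filter κ} {f : κ → ι}
    (hf : Tendsto f W L) :
    IsTailRegular W (fun q => n (f q)) (fun q => k (f q)) (fun q => x (f q)) b
      (fun q => d (f q)) α where
  tendsto_k := h.tendsto_k.comp hf
  k_le := hf.eventually h.k_le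
  d_pos q := h.d_pos (f q)
  le_b := hf.eventually h.le_b
  tendsto_tail u hu := (h.tendsto_tail u hu).comp hf

/-- By `lt_orderStat_iff`, the scaled distance is below `u` exactly when `i / k` is at most the tail
empirical function at `u`; strict monotonicity of `u ^ α` then separates `u < s` from `u > s`. -/
theorem tendsto_orderStat (h : IsTailRegular L n k x b d α) (hα : 0 < α) {i : ι → ℕ}
    (hi : ∀ᶠ p in L, 1 ≤ i p ∧ i p ≤ n p) {s : ℝ} (hs : 0 ≤ s)
    (his : Tendsto (fun p => (i p : ℝ) / k p) L (𝓝 (s ^ α))) :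
    Tendsto (fun p => (b - orderStat (x p) (i p)) / d p) L (𝓝 s) := by
  have hk : ∀ᶠ p in L, 0 < k p := h.tendsto_k.eventually_gt_atTop 0
  refine tendsto_order.2 ⟨fun a ha => ?_, fun a ha => ?_⟩
  · rcases lt_or_ge a 0 with ha0 | ha0
    · filter_upwards [hi, h.le_b] with p hp hb
      exact ha0.trans_le
        (div_nonneg (sub_nonneg.2 (orderStat_le hb hp.1 hp.2)) (h.d_pos p).le)
    · obtain ⟨u, hau, hus⟩ := exists_between ha
      have hu : 0 < u := ha0.trans_lt hau
      have := (h.tendsto_tail u hu).eventually_lt his (Real.rpow_lt_rpow hu.le hus hα)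
      filter_upwards [hi, hk, this] with p hp hkp hlt
      refine hau.trans_le (not_lt.1 fun hc => ?_)
      rw [← sub_mul_lt_iff (h.d_pos p), lt_orderStat_iff _ hp.1 hp.2] at hc
      have hk' : (0 : ℝ) < k p := by exact_mod_cast hkp
      rw [tailEmpirical, div_lt_div_iff_of_pos_right hk', Nat.cast_lt] at hlt
      omega
  · have := his.eventually_lt (h.tendsto_tail a (hs.trans_lt ha)) (Real.rpow_lt_rpow hs ha hα)
    filter_upwards [hi, hk, this] with p hp hkp hlt
    rw [← sub_mul_lt_iff (h.d_pos p), lt_orderStat_iff _ hp.1 hp.2]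
    have hk' : (0 : ℝ) < k p := by exact_mod_cast hkp
    rw [tailEmpirical, div_lt_div_iff_of_pos_right hk', Nat.cast_lt] at hlt
    exact hlt.le

theorem tendsto_integratedTail (h : IsTailRegular L n k x b d α) (hα : 0 < α) {u : ℝ}
    (hu : 0 < u) :
    Tendsto (fun p => integratedTail (x p) (k p) b (d p) u) L (𝓝 (u ^ (α + 1) / (α + 1))) := by
  have key := tendsto_integral_of_monotone (L := L)
    (f := fun p => tailEmpirical (x p) (k p) b (d p))
    (fun p => tailEmpirical_monotone (h.d_pos p)) (fun p => tailEmpirical_nonneg)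
    (g := fun u => u ^ α) (Real.continuous_rpow_const hα.le) h.tendsto_tail hu
  rw [integral_rpow (Or.inl (by linarith)), Real.zero_rpow (by positivity), sub_zero] at key
  refine key.congr' ?_
  filter_upwards [h.le_b] with p hp
  exact integral_tailEmpirical (h.d_pos p) hp hu.le

theorem tendsto_empiricalMeanExcess (h : IsTailRegular L n k x b d α) (hα : 0 < α) {s : ℝ}
    (hs : 0 ≤ s) {σ : ι → ℝ} (hσ0 : ∀ᶠ p in L, 0 ≤ σ p) (hσ : Tendsto σ L (𝓝 s)) :
    Tendsto (fun p => empiricalMeanExcess (x p) (b - σ p * d p) / d p) L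
      (𝓝 (s / (α + 1))) := by
  have hk : ∀ᶠ p in L, 0 < k p := h.tendsto_k.eventually_gt_atTop 0
  have heq : ∀ᶠ p in L, integratedTail (x p) (k p) b (d p) (σ p) /
      tailEmpirical (x p) (k p) b (d p) (σ p) =
        empiricalMeanExcess (x p) (b - σ p * d p) / d p := by
    filter_upwards [hk] with p hp
    exact (empiricalMeanExcess_div (h.d_pos p) hp _).symm
  refine Tendsto.congr' heq ?_
  -- At `s = 0` the limit quotient is `0 / 0`, so the ratio is squeezed between `0` and `σ`; this
  -- also covers an empty set of exceedances.
  rcases hs.eq_or_lt with rfl | hs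
  · rw [zero_div]
    refine tendsto_of_tendsto_of_tendsto_of_le_of_le' tendsto_const_nhds hσ ?_ ?_
    · exact Eventually.of_forall fun p =>
        div_nonneg (integratedTail_nonneg _) (tailEmpirical_nonneg _)
    · filter_upwards [hσ0, h.le_b] with p hp hb
      exact div_le_of_le_mul₀ (tailEmpirical_nonneg _) hp (integratedTail_le (h.d_pos p) hb _)
  · have h1 := tendsto_apply_of_monotone (L := L)
      (f := fun p => tailEmpirical (x p) (k p) b (d p))
      (fun p => tailEmpirical_monotone (h.d_pos p)) hs (g := fun u => u ^ α)
      (Real.continuous_rpow_const hα.le).continuousAt dense_univ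
      (fun u _ hu => h.tendsto_tail u hu) hσ
    have h2 := tendsto_apply_of_monotone (L := L)
      (f := fun p => integratedTail (x p) (k p) b (d p))
      (fun p => integratedTail_monotone) hs (g := fun u => u ^ (α + 1) / (α + 1))
      ((Real.continuous_rpow_const (by positivity)).div_const _).continuousAt dense_univ
      (fun u _ hu => h.tendsto_integratedTail hα hu) hσ
    have h3 := h2.div h1 (Real.rpow_pos_of_pos hs α).ne'
    have h4 : s ^ (α + 1) / (α + 1) / s ^ α = s / (α + 1) := by
      rw [Real.rpow_add_one hs.ne']
      have := (Real.rpow_pos_of_pos hs α).ne'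
      field_simp
    rwa [h4] at h3

theorem tendsto_orderStat_one (h : IsTailRegular L n k x b d α) (hα : 0 < α) :
    Tendsto (fun p => (b - orderStat (x p) 1) / d p) L (𝓝 0) := by
  refine h.tendsto_orderStat hα (i := fun _ => 1) ?_ le_rfl ?_
  · filter_upwards [h.tendsto_k.eventually_ge_atTop 1, h.k_le] with p h1 h2
    exact ⟨le_rfl, h1.trans h2⟩
  · rw [Real.zero_rpow hα.ne']
    exact (tendsto_natCast_atTop_atTop.comp h.tendsto_k).const_div_atTop _

theorem tendsto_orderStat_k (h : IsTailRegular L n k x b d α) (hα : 0 < α) :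
    Tendsto (fun p => (b - orderStat (x p) (k p)) / d p) L (𝓝 1) := by
  refine h.tendsto_orderStat hα ?_ zero_le_one ?_
  · filter_upwards [h.tendsto_k.eventually_ge_atTop 1, h.k_le] with p h1 h2
    exact ⟨h1, h2⟩
  · rw [Real.one_rpow]
    refine tendsto_const_nhds.congr' ?_
    filter_upwards [h.tendsto_k.eventually_gt_atTop 0] with p hp
    rw [div_self (by positivity)]

/-- The points of the normalized mean excess plot. -/
theorem tendsto_plot_point (h : IsTailRegular L n k x b d α) (hα : 0 < α) {i : ι → ℕ}
    (hi : ∀ᶠ p in L, i p ∈ Set.Ioc 1 (k p)) {s : ℝ} (hs : 0 ≤ s)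
    (his : Tendsto (fun p => (b - orderStat (x p) (i p)) / d p) L (𝓝 s)) :
    Tendsto (fun p => (1 / (orderStat (x p) 1 - orderStat (x p) (k p))) •
      (orderStat (x p) (i p) - orderStat (x p) (k p),
        empiricalMeanExcess (x p) (orderStat (x p) (i p)))) L (𝓝 (1 - s, s / (α + 1))) := by
  have h1 := h.tendsto_orderStat_one hα
  have hk := h.tendsto_orderStat_k hα
  have hden := hk.sub h1
  rw [sub_zero] at hden
  have hpos : ∀ᶠ p in L, 0 ≤ (b - orderStat (x p) (i p)) / d p := by
    filter_upwards [hi, h.k_le, h.le_b] with p hp hkn hb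
    exact div_nonneg (sub_nonneg.2 (orderStat_le hb hp.1.le (hp.2.trans hkn))) (h.d_pos p).le
  have hM := h.tendsto_empiricalMeanExcess hα hs hpos his
  have hx := (hk.sub his).div hden one_ne_zero
  have hy := hM.div hden one_ne_zero
  rw [div_one] at hx hy
  refine (hx.prodMk_nhds hy).congr fun p => ?_
  have hd := (h.d_pos p).ne'
  have e : ∀ y z : ℝ, (b - y) / d p - (b - z) / d p = (z - y) / d p := fun y z => by ring
  simp only [Pi.div_apply, e, Prod.smul_mk, smul_eq_mul, div_div_div_cancel_right₀ hd,
    div_mul_cancel₀ _ hd, sub_sub_cancel, one_div_mul_eq_div]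

/-- Deterministic convergence of the normalized mean excess plots in the Fell topology. -/
theorem tendsto_normalizedMEPlot (h : IsTailRegular L n k x b d α) (hα : 0 < α) {ξ : ℝ}
    (hξ : ξ < 0) (hαξ : α = -(1 / ξ)) :
    Tendsto (fun p => normalizedMEPlot (x p) (k p)) L
      (@nhds _ (fellTopology (ℝ × ℝ)) (limitSegment ξ)) := by
  have hline : ∀ t : ℝ, (1 - t) / (α + 1) = ξ / (1 - ξ) * (t - 1) := by
    intro t
    have h0 := hξ.ne
    have h1 : 1 - ξ ≠ 0 := by linarith
    have h2 : α + 1 = -(1 - ξ) / ξ := by rw [hαξ]; field_simp; ring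
    rw [h2]
    field_simp
    ring
  refine tendsto_nhds_generateFrom_iff.2 ?_
  rintro _ (⟨K, hK, rfl⟩ | ⟨G, hG, rfl⟩) hS
  · by_contra hcon
    -- If the plots do not eventually miss `K`, the pairs (sample, index) whose plot point lies in
    -- `K` carry an ultrafilter over `L`. Along it the scaled distances converge by compactness, and
    -- the limiting plot point lies in both `K` and the segment.
    let z : ι × ℕ → ℝ × ℝ := fun q =>
      (1 / (orderStat (x q.1) 1 - orderStat (x q.1) (k q.1))) •
        (orderStat (x q.1) q.2 - orderStat (x q.1) (k q.1),
          empiricalMeanExcess (x q.1) (orderStat (x q.1) q.2))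
    let B : Set (ι × ℕ) := {q | q.2 ∈ Set.Ioc 1 (k q.1) ∧ z q ∈ K}
    have hne : (comap Prod.fst L ⊓ 𝓟 B).NeBot := by
      rw [inf_principal_neBot_iff]
      rintro U ⟨V, hV, hVU⟩
      by_contra hempty
      refine hcon (mem_of_superset hV fun p hp => ?_)
      simp only [Set.mem_preimage, Set.mem_ofPred_eq]
      rw [← Set.not_nonempty_iff_eq_empty]
      rintro ⟨_, ⟨i, hi, rfl⟩, hiK⟩
      exact hempty ⟨(p, i), hVU hp, hi, hiK⟩
    let W : Ultrafilter (ι × ℕ) := Ultrafilter.of (comap Prod.fst L ⊓ 𝓟 B)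
    have hW : (W : Filter (ι × ℕ)) ≤ comap Prod.fst L ⊓ 𝓟 B := Ultrafilter.of_le _
    have hfst : Tendsto Prod.fst (W : Filter (ι × ℕ)) L :=
      tendsto_comap.mono_left (hW.trans inf_le_left)
    have hB : ∀ᶠ q in (W : Filter (ι × ℕ)), q ∈ B := hW (mem_inf_of_right (mem_principal_self B))
    have hreg := h.comp hfst
    have hbd : ∀ᶠ q in (W : Filter (ι × ℕ)),
        0 ≤ (b - orderStat (x q.1) q.2) / d q.1 ∧
          (b - orderStat (x q.1) q.2) / d q.1 ≤ (b - orderStat (x q.1) (k q.1)) / d q.1 := by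
      filter_upwards [hB, hreg.k_le, hreg.le_b] with q hq hkn hb
      refine ⟨div_nonneg (sub_nonneg.2 (orderStat_le hb hq.1.1.le (hq.1.2.trans hkn)))
        (h.d_pos _).le, div_le_div_of_nonneg_right ?_ (h.d_pos _).le⟩
      linarith [orderStat_antitone (x q.1) hq.1.1.le hq.1.2 hkn]
    have hk := hreg.tendsto_orderStat_k hα
    have hIcc : ∀ᶠ q in (W : Filter (ι × ℕ)),
        (b - orderStat (x q.1) q.2) / d q.1 ∈ Set.Icc (0 : ℝ) 2 := by
      filter_upwards [hbd, hk.eventually (gt_mem_nhds one_lt_two)] with q hq hq2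
      exact ⟨hq.1, hq.2.trans hq2.le⟩
    obtain ⟨s, -, hs⟩ := (isCompact_Icc (a := (0 : ℝ)) (b := 2)).ultrafilter_le_nhds
      (W.map fun q => (b - orderStat (x q.1) q.2) / d q.1) (tendsto_principal.2 hIcc)
    have hs' : Tendsto (fun q : ι × ℕ => (b - orderStat (x q.1) q.2) / d q.1) W (𝓝 s) := hs
    have hs0 : 0 ≤ s := ge_of_tendsto hs' (hbd.mono fun q hq => hq.1)
    have hs1 : s ≤ 1 := le_of_tendsto_of_tendsto hs' hk (hbd.mono fun q hq => hq.2)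
    have hz := hreg.tendsto_plot_point hα (i := Prod.snd) (hB.mono fun q hq => hq.1) hs0 hs'
    have hzK : (1 - s, s / (α + 1)) ∈ K :=
      hK.isClosed.mem_of_tendsto hz (hB.mono fun q hq => hq.2)
    have hzS : (1 - s, s / (α + 1)) ∈ (limitSegment ξ : Set (ℝ × ℝ)) := by
      refine ⟨1 - s, ⟨by linarith, by linarith⟩, ?_⟩
      simp only [← hline, sub_sub_cancel]
    have hmem : (1 - s, s / (α + 1)) ∈ (limitSegment ξ : Set (ℝ × ℝ)) ∩ K := ⟨hzS, hzK⟩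
    have hdisj : (limitSegment ξ : Set (ℝ × ℝ)) ∩ K = ∅ := hS
    rwa [hdisj] at hmem
  · obtain ⟨_, ⟨t₀, ht₀, rfl⟩, htG⟩ := hS
    let f : ℝ → ℝ × ℝ := fun t => (t, ξ / (1 - ξ) * (t - 1))
    have hf : Continuous f := by fun_prop
    -- Moving to an interior parameter gives `0 < s < 1`, so that the index `⌈s ^ α * k⌉₊`
    -- eventually lies in `(1, k]`.
    have hcl : t₀ ∈ closure (Set.Ioo (0 : ℝ) 1) := by rwa [closure_Ioo zero_ne_one]
    obtain ⟨t, htG, ht⟩ := mem_closure_iff.1 hcl (f ⁻¹' G) (hG.preimage hf) htG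
    set s := 1 - t with hs
    have hs0 : 0 < s := by linarith [ht.2]
    have hs1 : s < 1 := by linarith [ht.1]
    have hsα0 := Real.rpow_pos_of_pos hs0 α
    have hsα1 := Real.rpow_lt_one hs0.le hs1 hα
    have hkR : Tendsto (fun p => (k p : ℝ)) L atTop :=
      tendsto_natCast_atTop_atTop.comp h.tendsto_k
    let i : ι → ℕ := fun p => ⌈s ^ α * k p⌉₊
    have hi : ∀ᶠ p in L, i p ∈ Set.Ioc 1 (k p) := by
      filter_upwards [(hkR.const_mul_atTop hsα0).eventually_gt_atTop 1] with p hp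
      refine ⟨Nat.lt_ceil.2 (by simpa using hp), Nat.ceil_le.2 ?_⟩
      exact mul_le_of_le_one_left (Nat.cast_nonneg _) hsα1.le
    have hik : Tendsto (fun p => (i p : ℝ) / k p) L (𝓝 (s ^ α)) :=
      (tendsto_nat_ceil_mul_div_atTop hsα0.le).comp hkR
    have his := h.tendsto_orderStat hα (by
      filter_upwards [hi, h.k_le] with p hp hkn
      exact ⟨hp.1.le, hp.2.trans hkn⟩) hs0.le hik
    have hz := h.tendsto_plot_point hα hi hs0.le his
    have hmem : (1 - s, s / (α + 1)) ∈ G := by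
      have : f t = (1 - s, s / (α + 1)) := by
        simp only [f, ← hline, hs, sub_sub_cancel]
      rw [← this]
      exact htG
    filter_upwards [hz (hG.mem_nhds hmem), hi] with p hp hip
    exact ⟨_, ⟨i p, hip, rfl⟩, hp⟩

end IsTailRegular

end

/-! ### Convergence in probability and the weak law. -/

noncomputable section

/-- The filter of convergence in probability: `Z n` converges in probability to `z` if and only if
`fun p => Z p.1 p.2` tends to `z` along this filter. -/
def inProbability {Ω : Type*} [MeasurableSpace Ω] (P : Measure Ω) : Filter (ℕ × Ω) where
  sets := {A | Tendsto (fun n => P {ω | (n, ω) ∉ A}) atTop (𝓝 0)}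
  univ_sets := by simp
  sets_of_superset {A B} hA hAB := tendsto_of_tendsto_of_tendsto_of_le_of_le tendsto_const_nhds hA
    (fun _ => zero_le) fun _ => measure_mono fun _ hω h => hω (hAB h)
  inter_sets {A B} hA hB := by
    have hAB := Tendsto.add hA hB
    rw [add_zero] at hAB
    refine tendsto_of_tendsto_of_tendsto_of_le_of_le tendsto_const_nhds hAB
      (fun _ => zero_le) fun n => (measure_mono fun ω hω => ?_).trans (measure_union_le _ _)
    by_cases h : (n, ω) ∈ A
    · exact Or.inr fun h' => hω ⟨h, h'⟩
    · exact Or.inl h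

section

variable {Ω : Type*} [MeasurableSpace Ω] {P : Measure Ω}

theorem eventually_inProbability {q : ℕ × Ω → Prop} :
    (∀ᶠ p in inProbability P, q p) ↔
      Tendsto (fun n => P {ω | ¬ q (n, ω)}) atTop (𝓝 0) := Iff.rfl

theorem tendsto_fst_inProbability : Tendsto Prod.fst (inProbability P) atTop := by
  intro s hs
  refine (tendsto_const_nhds (x := (0 : ENNReal))).congr' ?_
  filter_upwards [hs] with n hn
  simp [hn]

theorem eventually_inProbability_of_ae {q : Ω → Prop} (h : ∀ᵐ ω ∂P, q ω) :
    ∀ᶠ p in inProbability P, q p.2 := by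
  rw [eventually_inProbability]
  simp only [ae_iff.1 h]
  exact tendsto_const_nhds

theorem tendstoInProbability_of_tendsto {E : Type*} {τ : TopologicalSpace E} {Z : ℕ → Ω → E}
    {z : E} (h : Tendsto (fun p : ℕ × Ω => Z p.1 p.2) (inProbability P) (@nhds E τ z)) :
    TendstoInProbability P τ Z z := fun _ hU hz =>
  eventually_inProbability.1 (h (hU.mem_nhds hz))

/-- Chebyshev's inequality: the variance of an indicator is at most its mean, so the count has
variance at most `n * q`. -/
theorem measure_le_exceedanceCount_sub [IsProbabilityMeasure P] {X : ℕ → Ω → ℝ}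
    (hX : ∀ j, Measurable (X j)) (hindep : iIndepFun X P) {u q : ℝ}
    (hq : ∀ j, P.real {ω | u < X j ω} = q) (n : ℕ) {c : ℝ} (hc : 0 < c) :
    P {ω | c ≤ |(exceedanceCount (fun j : Fin n => X j ω) u : ℝ) - n * q|} ≤
      ENNReal.ofReal (n * q / c ^ 2) := by
  let φ : ℝ → ℝ := (Set.Ioi u).indicator 1
  have hφ : Measurable φ := measurable_one.indicator measurableSet_Ioi
  let Y : Fin n → Ω → ℝ := fun j => φ ∘ X j
  have hYm : ∀ j, Measurable (Y j) := fun j => hφ.comp (hX j)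
  have hYind : ∀ j, Y j = {ω | u < X j ω}.indicator 1 := fun j => by
    ext ω; simp [Y, φ, Set.indicator_apply]
  have hset : ∀ j, MeasurableSet {ω | u < X j ω} := fun j =>
    measurableSet_lt measurable_const (hX j)
  have hY2 : ∀ j, MemLp (Y j) 2 P := fun j => by
    rw [hYind]
    exact (memLp_const 1).indicator (hset j)
  have hYint : ∀ j, ∫ ω, Y j ω ∂P = q := fun j => by
    rw [hYind, integral_indicator_one (hset j), hq]
  have hcount : ∀ ω, (exceedanceCount (fun j : Fin n => X j ω) u : ℝ) = (∑ j, Y j) ω := by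
    intro ω
    rw [cast_exceedanceCount, Finset.sum_apply]
    simp [Y, φ, Set.indicator_apply]
  have hmean : ∫ ω, (∑ j, Y j) ω ∂P = n * q := by
    simp only [Finset.sum_apply]
    rw [integral_finsetSum _ fun j _ => (hY2 j).integrable one_le_two]
    simp [hYint]
  have hvar : Var[∑ j, Y j; P] ≤ n * q := by
    rw [IndepFun.variance_sum (fun j _ => hY2 j) fun i _ j _ hij =>
      ((hindep.indepFun (Fin.val_injective.ne hij)).comp hφ hφ)]
    calc ∑ j, Var[Y j; P] ≤ ∑ j : Fin n, q := Finset.sum_le_sum fun j _ => by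
          refine (variance_le_expectation_sq (hYm j).aestronglyMeasurable).trans_eq ?_
          rw [← hYint j]
          congr 1
          ext ω
          simp [hYind, Set.indicator_apply]
      _ = n * q := by simp
  have hL2 : MemLp (∑ j, Y j) 2 P := memLp_finsetSum' _ fun j _ => hY2 j
  have := meas_ge_le_variance_div_sq hL2 hc
  rw [hmean] at this
  simp only [hcount]
  exact this.trans (ENNReal.ofReal_le_ofReal (by gcongr))

/-- Weak law of large numbers for the number of exceedances of intermediate levels. -/
theorem tendsto_exceedanceCount_div [IsProbabilityMeasure P] {X : ℕ → Ω → ℝ}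
    (hX : ∀ j, Measurable (X j)) (hindep : iIndepFun X P) {u q : ℕ → ℝ}
    (hq : ∀ n j, P.real {ω | u n < X j ω} = q n) {k : ℕ → ℕ} (hk : Tendsto k atTop atTop) {c : ℝ}
    (hc : Tendsto (fun n : ℕ => (n : ℝ) * q n / k n) atTop (𝓝 c)) :
    Tendsto (fun p : ℕ × Ω =>
      (exceedanceCount (fun j : Fin p.1 => X j p.2) (u p.1) : ℝ) / k p.1)
      (inProbability P) (𝓝 c) := by
  have hkR : Tendsto (fun n => (k n : ℝ)) atTop atTop := tendsto_natCast_atTop_atTop.comp hk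
  have hdiff : Tendsto (fun p : ℕ × Ω =>
      ((exceedanceCount (fun j : Fin p.1 => X j p.2) (u p.1) : ℝ) - p.1 * q p.1) / k p.1)
      (inProbability P) (𝓝 0) := by
    refine Metric.tendsto_nhds.2 fun ε hε => ?_
    rw [eventually_inProbability]
    -- The bound is `(n * q / k) / k / ε ^ 2`, a convergent sequence divided by `k → ∞`.
    have hb : Tendsto (fun n : ℕ => ENNReal.ofReal ((n : ℝ) * q n / (ε * k n) ^ 2)) atTop (𝓝 0) := by
      have h1 := (hc.div_atTop hkR).div_const (ε ^ 2)
      rw [zero_div] at h1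
      have h2 := ENNReal.tendsto_ofReal h1
      rw [ENNReal.ofReal_zero] at h2
      refine h2.congr fun n => ?_
      congr 1
      rw [div_div, div_div]
      congr 1
      ring
    refine tendsto_of_tendsto_of_tendsto_of_le_of_le' tendsto_const_nhds hb
      (Eventually.of_forall fun _ => zero_le) ?_
    filter_upwards [hkR.eventually_gt_atTop 0] with n hn
    refine (measure_mono fun ω hω => ?_).trans
      (measure_le_exceedanceCount_sub hX hindep (hq n) n (mul_pos hε hn))
    simp only [Set.mem_ofPred_eq, not_lt, dist_zero_right, Real.norm_eq_abs, abs_div,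
      abs_of_pos hn, le_div_iff₀ hn] at hω
    exact hω
  have := hdiff.add (hc.comp tendsto_fst_inProbability)
  rw [zero_add] at this
  refine this.congr fun p => ?_
  simp only [Function.comp_apply]
  ring

end

/-! ### Regular variation at zero and the choice of scale. -/

section

variable {G : ℝ → ℝ} {α : ℝ}

/-- A nonzero right limit at `0` would force `G (s / 2) / G s → 1`, against `(1 / 2) ^ α < 1`. -/
theorem tendsto_zero_of_regularlyVarying (hG : Monotone G) (hα : 0 < α)
    (hRV : ∀ u, 0 < u → Tendsto (fun s => G (u * s) / G s) (𝓝[>] 0) (𝓝 (u ^ α))) :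
    Tendsto G (𝓝[>] 0) (𝓝 0) := by
  have hlim := hG.tendsto_nhdsGT 0
  set c := sInf (G '' Set.Ioi 0)
  by_cases hc : c = 0
  · rwa [hc] at hlim
  · have hhalf : Tendsto (fun s : ℝ => 1 / 2 * s) (𝓝[>] 0) (𝓝[>] 0) := by
      refine tendsto_nhdsWithin_iff.2 ⟨?_, ?_⟩
      · have : Tendsto (fun s : ℝ => 1 / 2 * s) (𝓝 0) (𝓝 (1 / 2 * 0)) :=
          tendsto_id.const_mul _
        rw [mul_zero] at this
        exact this.mono_left nhdsWithin_le_nhds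
      · filter_upwards [self_mem_nhdsWithin] with s hs
        exact mul_pos one_half_pos (Set.mem_Ioi.1 hs)
    have h1 := (hlim.comp hhalf).div hlim hc
    rw [div_self hc] at h1
    have h2 := tendsto_nhds_unique h1 (hRV (1 / 2) one_half_pos)
    exact absurd h2 (Real.rpow_lt_one (by norm_num) (by norm_num) hα).ne'

/-- Take the supremum of `{y | G y ≤ r}`. Since `G` may jump there, nothing is claimed about its
value at `d`. -/
theorem exists_quantile (hG : Monotone G) (h0 : Tendsto G (𝓝[>] 0) (𝓝 0))
    (h1 : Tendsto G atTop (𝓝 1)) {r : ℝ} (hr0 : 0 < r) (hr1 : r < 1) :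
    ∃ d, 0 < d ∧ (∀ y, d < y → r < G y) ∧ ∀ y, y < d → G y ≤ r := by
  obtain ⟨b, hb⟩ := (h1.eventually (lt_mem_nhds hr1)).exists
  obtain ⟨a, ha, ha0⟩ := ((h0.eventually (gt_mem_nhds hr0)).and self_mem_nhdsWithin).exists
  have hbdd : BddAbove {y | G y ≤ r} :=
    ⟨b, fun y hy => not_lt.1 fun hlt => absurd (hb.trans_le (hG hlt.le)) (not_lt.2 hy)⟩
  have hne : {y | G y ≤ r}.Nonempty := ⟨a, ha.le⟩
  refine ⟨sSup {y | G y ≤ r}, lt_of_lt_of_le ha0 (le_csSup hbdd ha.le), fun y hy => ?_,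
    fun y hy => ?_⟩
  · exact not_le.1 fun h => absurd (le_csSup hbdd h) (not_le.2 hy)
  · obtain ⟨z, hz, hyz⟩ := exists_lt_of_lt_csSup hne hy
    exact (hG hyz.le).trans hz

/-- Normalizing constants for a regularly varying tail. -/
theorem exists_scale (hG : Monotone G) (hpos : ∀ y, 0 < y → 0 < G y) (hα : 0 < α)
    (hRV : ∀ u, 0 < u → Tendsto (fun s => G (u * s) / G s) (𝓝[>] 0) (𝓝 (u ^ α)))
    (h1 : Tendsto G atTop (𝓝 1)) {r : ℕ → ℝ} (hr : Tendsto r atTop (𝓝[>] 0)) :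
    ∃ d : ℕ → ℝ, (∀ n, 0 < d n) ∧
      ∀ u, 0 < u → Tendsto (fun n => G (u * d n) / r n) atTop (𝓝 (u ^ α)) := by
  have h0 := tendsto_zero_of_regularlyVarying hG hα hRV
  have hr' := tendsto_nhdsWithin_iff.1 hr
  have hex : ∀ n, ∃ d, 0 < d ∧
      (0 < r n → r n < 1 → (∀ y, d < y → r n < G y) ∧ ∀ y, y < d → G y ≤ r n) := by
    intro n
    by_cases h : 0 < r n ∧ r n < 1
    · obtain ⟨d, hd, hd'⟩ := exists_quantile hG h0 h1 h.1 h.2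
      exact ⟨d, hd, fun _ _ => hd'⟩
    · exact ⟨1, one_pos, fun ha hb => absurd ⟨ha, hb⟩ h⟩
  choose d hd hd' using hex
  have hev : ∀ᶠ n in atTop, 0 < r n ∧ (∀ y, d n < y → r n < G y) ∧ ∀ y, y < d n → G y ≤ r n := by
    filter_upwards [hr'.2, hr'.1.eventually (gt_mem_nhds one_pos)] with n ha hb
    exact ⟨ha, hd' n ha hb⟩
  have hd0 : Tendsto d atTop (𝓝[>] 0) := by
    refine tendsto_nhdsWithin_iff.2 ⟨tendsto_order.2 ⟨fun a ha => ?_, fun a ha => ?_⟩,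
      Eventually.of_forall hd⟩
    · exact Eventually.of_forall fun n => ha.trans (hd n)
    · filter_upwards [hev, hr'.1.eventually (gt_mem_nhds (hpos _ (half_pos ha)))] with n hn hlt
      have : d n ≤ a / 2 := not_lt.1 fun h => absurd (hn.2.2 _ h) (not_le.2 hlt)
      linarith
  -- A jump of `G` at `d n` is harmless asymptotically: `r n` lies between the values of `G` at `c ^
  -- α⁻¹ * d n` for `c < 1` and for `c > 1`, whose ratios to `G (d n)` tend to `c`.
  have hratio : Tendsto (fun n => r n / G (d n)) atTop (𝓝 1) := by
    have hroot : ∀ c : ℝ, 0 < c →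
        Tendsto (fun n => G (c ^ α⁻¹ * d n) / G (d n)) atTop (𝓝 c) := by
      intro c hc
      have := (hRV (c ^ α⁻¹) (Real.rpow_pos_of_pos hc _)).comp hd0
      rwa [← Real.rpow_mul hc.le, inv_mul_cancel₀ hα.ne', Real.rpow_one] at this
    refine tendsto_order.2 ⟨fun a ha => ?_, fun a ha => ?_⟩
    · obtain ⟨c, hac, hc1⟩ := exists_between (max_lt ha one_pos)
      have hc0 : 0 < c := (le_max_right _ _).trans_lt hac
      filter_upwards [hev, (hroot c hc0).eventually
        (lt_mem_nhds ((le_max_left _ _).trans_lt hac))] with n hn hlt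
      refine hlt.trans_le (div_le_div_of_nonneg_right (hn.2.2 _ ?_) (hpos _ (hd n)).le)
      exact mul_lt_of_lt_one_left (hd n) (Real.rpow_lt_one hc0.le hc1 (inv_pos.2 hα))
    · obtain ⟨c, hc1, hca⟩ := exists_between ha
      filter_upwards [hev, (hroot c (one_pos.trans hc1)).eventually (gt_mem_nhds hca)]
        with n hn hlt
      refine lt_of_le_of_lt (div_le_div_of_nonneg_right (hn.2.1 _ ?_).le (hpos _ (hd n)).le) hlt
      exact lt_mul_of_one_lt_left (hd n) (Real.one_lt_rpow hc1 (inv_pos.2 hα))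
  refine ⟨d, hd, fun u hu => ?_⟩
  have := ((hRV u hu).comp hd0).div hratio one_ne_zero
  rw [div_one] at this
  exact this.congr fun n => div_div_div_cancel_right₀ (hpos _ (hd n)).ne' _ _

end

end

/-! ### Assembly of the theorem. -/

theorem theorem3p5 {Ω : Type*} [MeasurableSpace Ω] (P : Measure Ω) [IsProbabilityMeasure P]
    (X : ℕ → Ω → ℝ) (hX : ∀ j, Measurable (X j)) (hindep : iIndepFun X P)
    (F : ℝ → ℝ) (hF : ∀ j x, cdf (P.map (X j)) x = F x)
    (xF : ℝ) (hxF : IsLUB {x : ℝ | F x < 1} xF)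
    (ξ : ℝ) (hξ : ξ < 0)
    (hRV : RegularlyVarying (fun x => 1 - F (xF - x⁻¹)) (1 / ξ))
    (k : ℕ → ℕ) (hk : Tendsto k atTop atTop)
    (hkn : Tendsto (fun n => (k n : ℝ) / (n : ℝ)) atTop (𝓝 0)) :
    TendstoInProbability P (fellTopology (ℝ × ℝ))
      (fun n ω => normalizedMEPlot (fun j : Fin n => X j ω) (k n)) (limitSegment ξ) := by
  have hF0 : ∀ y, F y = cdf (P.map (X 0)) y := fun y => (hF 0 y).symm
  have hFmono : Monotone F := fun a b hab => by
    rw [hF0, hF0]; exact monotone_cdf _ hab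
  have htail : ∀ u j, P.real {ω | u < X j ω} = 1 - F u := by
    intro u j
    have := Measure.isProbabilityMeasure_map (μ := P) (hX j).aemeasurable
    rw [← hF j u, cdf_eq_real, ← probReal_compl_eq_one_sub measurableSet_Iic, Set.compl_Iic,
      map_measureReal_apply (hX j) measurableSet_Ioi]
    rfl
  have hFxF : F xF = 1 := by
    have hright : ContinuousWithinAt F (Set.Ici xF) xF := by
      rw [funext hF0]
      exact (cdf (P.map (X 0))).right_continuous xF
    have h1 : ∀ y, xF < y → F y = 1 := fun y hy => by
      refine le_antisymm ?_ (not_lt.1 fun h => absurd (hxF.1 h) (not_le.2 hy))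
      rw [hF0]
      exact cdf_le_one _ _
    have h2 : Tendsto F (𝓝[>] xF) (𝓝 (F xF)) :=
      hright.mono_left (nhdsWithin_mono _ Set.Ioi_subset_Ici_self)
    refine tendsto_nhds_unique h2 (tendsto_const_nhds.congr' ?_)
    filter_upwards [self_mem_nhdsWithin] with y hy
    exact (h1 y hy).symm
  have hle : ∀ᵐ ω ∂P, ∀ j, X j ω ≤ xF := by
    refine ae_all_iff.2 fun j => ?_
    rw [ae_iff]
    simp only [not_le]
    have := htail xF j
    rw [hFxF, sub_self] at this
    exact (measureReal_eq_zero_iff).1 this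
  let α := -(1 / ξ)
  have hα : 0 < α := neg_pos.2 (one_div_neg.2 hξ)
  let G : ℝ → ℝ := fun y => 1 - F (xF - y)
  have hG : Monotone G := fun a b hab => sub_le_sub_left (hFmono (by linarith)) 1
  have hGpos : ∀ y, 0 < y → 0 < G y := by
    intro y hy
    obtain ⟨z, hz, hyz, -⟩ := hxF.exists_between (show xF - y < xF by linarith)
    exact sub_pos.2 ((hFmono hyz.le).trans_lt hz)
  have hG1 : Tendsto G atTop (𝓝 1) := by
    have h1 : Tendsto (fun y : ℝ => xF - y) atTop atBot :=
      tendsto_atBot_add_const_left _ xF tendsto_neg_atTop_atBot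
    have h2 := ((tendsto_cdf_atBot (P.map (X 0))).comp h1).const_sub 1
    rw [sub_zero] at h2
    exact h2.congr fun y => by simp [G, hF0]
  have hGRV : ∀ u, 0 < u → Tendsto (fun s => G (u * s) / G s) (𝓝[>] 0) (𝓝 (u ^ α)) := by
    intro u hu
    -- Substituting `t = s⁻¹` and `x = u⁻¹` turns regular variation at infinity with index `1 / ξ`
    -- into regular variation of `G` at `0` with index `α`.
    have := (hRV u⁻¹ (inv_pos.2 hu)).comp tendsto_inv_nhdsGT_zero
    rw [Real.inv_rpow hu.le, ← Real.rpow_neg hu.le] at this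
    refine this.congr fun s => ?_
    simp only [Function.comp_apply, mul_inv, inv_inv, G, mul_comm s u]
  have hr : Tendsto (fun n => (k n : ℝ) / (n : ℝ)) atTop (𝓝[>] 0) := by
    refine tendsto_nhdsWithin_iff.2 ⟨hkn, ?_⟩
    filter_upwards [hk.eventually_gt_atTop 0, eventually_gt_atTop 0] with n h1 h2
    exact Set.mem_Ioi.2 (by positivity)
  obtain ⟨d, hd, hscale⟩ := exists_scale hG hGpos hα hGRV hG1 hr
  have hreg : IsTailRegular (inProbability P) Prod.fst (fun p => k p.1)
      (fun p (j : Fin p.1) => X j p.2) xF (fun p => d p.1) α := by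
    refine ⟨hk.comp tendsto_fst_inProbability, tendsto_fst_inProbability.eventually
        (p := fun n => k n ≤ n) ?_,
      fun p => hd p.1, (eventually_inProbability_of_ae hle).mono fun p hp j => hp j,
      fun u hu => ?_⟩
    · filter_upwards [hkn.eventually (gt_mem_nhds one_pos), eventually_gt_atTop 0] with n h1 h2
      rw [div_lt_one (by positivity)] at h1
      exact_mod_cast h1.le
    · refine tendsto_exceedanceCount_div hX hindep (u := fun n => xF - u * d n)
        (q := fun n => G (u * d n)) (fun n j => htail _ j) hk ((hscale u hu).congr fun n => ?_)
      rw [div_div_eq_mul_div, mul_comm]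
  exact tendstoInProbability_of_tendsto (hreg.tendsto_normalizedMEPlot hα hξ rfl)
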